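/- Let $G=(V,E)$ be a (known) directed graph with $n=|V|$ nodes and $m=|E|$ edges. In the discrete-time independent cascade (DIC) model with activation probabilities $w=(w_e)_{e\in E}\in[0,1]^E$ and seed set $S\subseteq V$, the seeds are active at time $0$; whenever a node $u$ becomes active at some time $t$, it makes, at time $t+1$, one independent attempt to activate each currently inactive node $v$ with $(u,v)\in E$, which succeeds with probability $w_{(u,v)}$. Let $\Delta^w_S$ be the distribution of the set of active nodes once no further activations occur, and let the influence function $F^w:2^V\to[0,1]^V$ be given by $F^w_v(S)=\Pr_{A\sim\Delta^w_S}[v\in A]$. For $\lambda\in(0,1/2)$ let $\mathcal F_\lambda=\{F^w : w\in[\lambda,1-\lambda]^E\}$. Given a distribution $\mathcal P$ on $2^V$ and a retention rate $r\in(0,1]$, an incomplete cascade is a pair $(S,\tilde A)$ obtained by drawing $S\sim\mathcal P$ and $A\sim\Delta^w_S$ and letting $\tilde A$ consist of all nodes of $S$ and of each node of $A\setminus S$ independently with probability $r$. For $F:2^V\to\mathbb R^V$ put $\mathrm{err}_{\mathcal P,w}[F]=\mathbb E_{S\sim\mathcal P,\,A\sim\Delta^w_S}\bigl[\tfrac1n\|\mathbf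 1_A-F(S)\|_2^2\bigr]$. Theorem. There are absolute constants $C>0$ and $k\in\mathbb N$ such that for all $\lambda\in(0,1/2)$, all $r\in(0,1]$ and all directed graphs $G$, the class $\mathcal F_\lambda$ is properly PAC learnable from incomplete cascades with retention rate $r$, with sample complexity $\tilde O\bigl(\tfrac{n^3m}{\varepsilon^2r^4}\bigr)$. Precisely: there is an algorithm $\mathcal A$ (which may depend on $G$, $\lambda$, $r$) that maps each finite sequence of pairs $(S_i,\tilde A_i)$ to an element of $\mathcal F_\lambda$ such that for all $\varepsilon,\delta\in(0,1)$, all $w\in[\lambda,1-\lambda]^E$, all distributions $\mathcal P$ on $2^V$, and all $$M\ \ge\ C\,\frac{n^3m}{\varepsilon^2r^4}\,\Bigl(\log\bigl(2+n+m+\tfrac1\varepsilon+\tfrac1\delta+\tfrac1r\bigr)\Bigr)^k,$$ if $D$ is a sequence of $M$ independent incomplete cascades, then $$\Pr_D\bigl[\mathrm{err}_{\mathcal P,w}[\mathcal A(D)]-\mathrm{err}_{\mathcal P,w}[F^w]\ge\varepsilon\bigr]\le\delta .$$ -/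

import Mathlib

open scoped unitInterval BigOperators

namespace Influence

noncomputable section

/-- Independent biased coins: `coins p` is the product distribution on `ι → Bool` under which the
coins are independent and coin `i` shows `true` with probability `p i`. -/
def coins {ι : Type*} [Fintype ι] [DecidableEq ι] (p : ι → I) : PMF (ι → Bool) :=
  PMF.ofFintype
    (fun c => ∏ i, if c i = true then ENNReal.ofReal (p i) else ENNReal.ofReal (1 - p i)) (by
      have h := Finset.prod_univ_sum (fun _ : ι => (Finset.univ : Finset Bool))
        (fun i b => if b = true then ENNReal.ofReal (p i : ℝ) else ENNReal.ofReal (1 - p i : ℝ))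
      rw [Fintype.piFinset_univ] at h
      rw [← h]
      refine Finset.prod_eq_one fun i _ => ?_
      rw [Fintype.sum_bool]
      simp only [if_true, Bool.false_eq_true, if_false]
      rw [← ENNReal.ofReal_add (p i).2.1 (sub_nonneg.2 (p i).2.2)]
      simp)

variable {V : Type*} [Fintype V] [DecidableEq V] {E : Finset (V × V)}

/-- The nodes that become active in one step: `s.1` is the set of active nodes, `s.2` the set of
nodes that became active in the previous step, and `c (u, v)` says whether an activation attempt
along the edge `(u, v)` succeeds. Only currently inactive `v` and newly active `u` matter. -/
def newlyActive (s : Finset V × Finset V) (c : E → Bool) : Finset V :=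
  Finset.univ.filter fun v => v ∉ s.1 ∧ ∃ u ∈ s.2, ∃ h : (u, v) ∈ E, c ⟨(u, v), h⟩ = true

/-- One step of the discrete-time independent cascade with activation probabilities `w`, acting on
pairs (active nodes, nodes that became active in the previous step). -/
def dicStep (w : E → I) (s : Finset V × Finset V) : PMF (Finset V × Finset V) :=
  (coins w).map fun c => (s.1 ∪ newlyActive s c, newlyActive s c)

/-- `t` steps of the cascade, started in the state `s`. Fresh coins are used in each step. -/
def dicRun (w : E → I) : ℕ → Finset V × Finset V → PMF (Finset V × Finset V)
  | 0, s => PMF.pure s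
  | t + 1, s => (dicStep w s).bind (dicRun w t)

lemma card_of_mem_support_dicRun (w : E → I) (t : ℕ) (s s' : Finset V × Finset V)
    (h : s' ∈ (dicRun w t s).support) : s'.2 = ∅ ∨ s.1.card + t ≤ s'.1.card := by
  induction t generalizing s with
  | zero =>
    right
    simp only [dicRun, PMF.mem_support_pure_iff] at h
    simp [h]
  | succ t ih =>
    simp only [dicRun, PMF.mem_support_bind_iff] at h
    obtain ⟨s1, h1, h2⟩ := h
    simp only [dicStep, PMF.mem_support_map_iff] at h1
    obtain ⟨c, -, rfl⟩ := h1
    by_cases hN : newlyActive s c = ∅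
    · left
      have key : ∀ (t : ℕ) (A : Finset V) (s' : Finset V × Finset V),
          s' ∈ (dicRun w t (A, ∅)).support → s'.2 = ∅ := by
        intro t
        induction t with
        | zero =>
          intro A s' h
          simp only [dicRun, PMF.mem_support_pure_iff] at h
          simp [h]
        | succ t iht =>
          intro A s' h
          simp only [dicRun, PMF.mem_support_bind_iff] at h
          obtain ⟨s1, h1, h2⟩ := h
          simp only [dicStep, PMF.mem_support_map_iff] at h1
          obtain ⟨c, -, rfl⟩ := h1
          have he : newlyActive (E := E) (A, ∅) c = ∅ := by simp [newlyActive]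
          rw [he] at h2
          exact iht _ _ h2
      rw [hN] at h2
      exact key t _ s' h2
    · rcases ih _ h2 with h3 | h3
      · exact Or.inl h3
      · right
        have hd : Disjoint s.1 (newlyActive s c) := by
          rw [Finset.disjoint_right]
          intro v hv
          exact (Finset.mem_filter.1 hv).2.1
        have hc := Finset.card_union_of_disjoint hd
        have hp := Finset.card_pos.2 (Finset.nonempty_iff_ne_empty.2 hN)
        simp only at h3
        omega

/-- The process started from seeds `S` has stopped after `|V|` steps: almost surely the last of
them activates no node. -/
lemma dicRun_stopped (w : E → I) (S : Finset V) (s' : Finset V × Finset V)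
    (h : s' ∈ (dicRun w (Fintype.card V) (S, S)).support) : s'.2 = ∅ := by
  by_contra hne
  rcases card_of_mem_support_dicRun w _ _ _ h with h1 | h1
  · exact hne h1
  · have h2 := Finset.card_le_univ s'.1
    have h3 : S = ∅ := Finset.card_eq_zero.1 (by simp only at h1; omega)
    subst h3
    have key : ∀ t : ℕ, (dicRun w t ((∅ : Finset V), (∅ : Finset V))) = PMF.pure (∅, ∅) := by
      intro t
      induction t with
      | zero => rfl
      | succ t ih =>
        have he : ∀ c, newlyActive (E := E) ((∅ : Finset V), (∅ : Finset V)) c = ∅ := by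
          intro c; simp [newlyActive]
        have hs : dicStep w ((∅ : Finset V), (∅ : Finset V)) = PMF.pure (∅, ∅) := by
          simp only [dicStep, he, Finset.union_empty]
          exact PMF.map_const _ _
        simp only [dicRun, hs, PMF.pure_bind, ih]
    rw [key, PMF.mem_support_pure_iff] at h
    exact hne (by rw [h])

/-- The distribution of the final active set of the cascade with seed set `S` (it is the set of
active nodes after `|V|` steps, when the process has stopped by `dicRun_stopped`). -/
def activeDist (w : E → I) (S : Finset V) : PMF (Finset V) :=
  (dicRun w (Fintype.card V) (S, S)).map Prod.fst

/-- The influence function: `influence w S v` is the probability that `v` is in the final active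
set when the seed set is `S`. -/
def influence (w : E → I) (S : Finset V) (v : V) : ℝ :=
  ∑ A : Finset V, if v ∈ A then (activeDist w S A).toReal else 0

/-- The parameter vectors all of whose activation probabilities lie in `[lam, 1 - lam]`. -/
def boundedWeights (E : Finset (V × V)) (lam : ℝ) : Set (E → I) :=
  {w | ∀ e, (w e : ℝ) ∈ Set.Icc lam (1 - lam)}

/-- The class of influence functions of the model on the graph `(V, E)` with activation
probabilities in `[lam, 1 - lam]`. -/
def dicClass (E : Finset (V × V)) (lam : ℝ) : Set (Finset V → V → ℝ) :=
  influence '' boundedWeights E lam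

/-- Incomplete observation of the active set `A` with seeds `S`: seeds are always observed, each
node of `A \ S` is observed independently with probability `r`. -/
def observe (r : I) (S A : Finset V) : PMF (Finset V) :=
  (coins fun _ : V => r).map fun c => S ∪ (A \ S).filter fun v => c v = true

/-- The distribution of an incomplete, activation-only cascade (seed set, observed active set),
when seed sets have distribution `P`. -/
def incompleteCascade (P : PMF (Finset V)) (w : E → I) (r : I) : PMF (Finset V × Finset V) :=
  P.bind fun S => (activeDist w S).bind fun A => (observe r S A).map fun O => (S, O)

/-- Quadratic loss `(1/n) ‖x - y‖₂²`. -/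
def sqLoss (x y : V → ℝ) : ℝ :=
  1 / (Fintype.card V : ℝ) * ∑ v, (x v - y v) ^ 2

/-- Squared error of `F`: the expected quadratic loss between the indicator vector of the
(completely observed) active set and `F S`, with seed sets drawn from `P` and ground truth `w`. -/
def err (P : PMF (Finset V)) (w : E → I) (F : Finset V → V → ℝ) : ℝ :=
  ∑ S : Finset V, (P S).toReal * ∑ A : Finset V, (activeDist w S A).toReal *
    sqLoss (fun v => if v ∈ A then 1 else 0) (F S)

/-- The class `dicClass E lam` is properly PAC learnable from activation-only cascades with
retention rate `r`, with sample complexity at most `N ε δ`. A learning algorithm maps every finite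
sequence of incomplete cascades to an influence function of the class; it may depend on the graph,
on `lam` and on `r`, but not on `ε`, `δ`, the distribution `P` of seed sets or the
ground truth `w`. -/
def ProperlyPACLearnable (E : Finset (V × V)) (lam : ℝ) (r : I) (N : ℝ → ℝ → ℝ) : Prop :=
  ∃ alg : (M : ℕ) → (Fin M → Finset V × Finset V) → Finset V → V → ℝ,
    (∀ M D, alg M D ∈ dicClass E lam) ∧
    ∀ ε ∈ Set.Ioo (0 : ℝ) 1, ∀ δ ∈ Set.Ioo (0 : ℝ) 1,
      ∀ w ∈ boundedWeights E lam, ∀ P : PMF (Finset V), ∀ M : ℕ, N ε δ ≤ (M : ℝ) →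
        MeasureTheory.Measure.pi (fun _ : Fin M => (incompleteCascade P w r).toMeasure)
          {D | ε ≤ err P w (alg M D) - err P w (influence w)} ≤ ENNReal.ofReal δ

end

end Influence

/-! The learner is exact empirical risk minimization over the compact weight set. Missing
observations are repaired by inverse propensity weighting: a seed gets value 1, any other observed
node 1/r, so the values estimate the indicator of the active set without bias. The quadratic loss of
these values is itself biased, but a difference of two losses is linear in them, so excess losses
are unbiased (`mean_observedLoss_sub`).

Uniform convergence comes from a finite cover. A cascade has at most n steps, so a hybrid argument
gives |F^w - F^w'| ≤ 2n‖w - w'‖₁ (`abs_influence_sub_le`), and a grid of (K+1)^m weight vectors with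
K of order nm/(εr) approximates every loss to within ε/4. Hoeffding for differences bounded by 2/r
and a union bound over the grid (`measure_excess_err_le`) need about m log(X)/(ε²r²) samples, where
X is the argument of the logarithm in the theorem; this is within the claimed bound. -/

namespace Influence

/-- The expectation of a real function under a probability distribution on a finite type. -/
noncomputable def mean {X : Type*} [Fintype X] (p : PMF X) (f : X → ℝ) : ℝ :=
  ∑ x, (p x).toReal * f x

/-! ### Expectations on finite probability spaces -/

section Mean

variable {X Y : Type*} [Fintype X] [Fintype Y]

lemma sum_toReal (p : PMF X) : ∑ x, (p x).toReal = 1 := by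
  have h := p.tsum_coe
  rw [tsum_fintype] at h
  rw [← ENNReal.toReal_sum fun x _ => p.apply_ne_top x, h, ENNReal.toReal_one]

lemma mean_const (p : PMF X) (a : ℝ) : mean p (fun _ => a) = a := by
  rw [mean, ← Finset.sum_mul, sum_toReal, one_mul]

lemma mean_sub (p : PMF X) (f g : X → ℝ) :
    mean p (fun x => f x - g x) = mean p f - mean p g := by
  simp only [mean, mul_sub, Finset.sum_sub_distrib]

lemma mean_const_mul (p : PMF X) (a : ℝ) (f : X → ℝ) :
    mean p (fun x => a * f x) = a * mean p f := by
  simp only [mean, Finset.mul_sum]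
  exact Finset.sum_congr rfl fun x _ => by ring

lemma mean_sum {ι : Type*} (s : Finset ι) (p : PMF X) (f : ι → X → ℝ) :
    mean p (fun x => ∑ i ∈ s, f i x) = ∑ i ∈ s, mean p (f i) := by
  simp only [mean, Finset.mul_sum]
  exact Finset.sum_comm

lemma mean_mono {p : PMF X} {f g : X → ℝ} (h : ∀ x, f x ≤ g x) : mean p f ≤ mean p g :=
  Finset.sum_le_sum fun x _ => mul_le_mul_of_nonneg_left (h x) ENNReal.toReal_nonneg

lemma abs_mean_le {p : PMF X} {f : X → ℝ} {b : ℝ} (h : ∀ x, |f x| ≤ b) : |mean p f| ≤ b := by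
  refine abs_le.2 ⟨?_, ?_⟩
  · rw [← mean_const p (-b)]
    exact mean_mono fun x => (abs_le.1 (h x)).1
  · rw [← mean_const p b]
    exact mean_mono fun x => (abs_le.1 (h x)).2

lemma mean_congr {p : PMF X} {f g : X → ℝ} (h : ∀ x ∈ p.support, f x = g x) :
    mean p f = mean p g := by
  refine Finset.sum_congr rfl fun x _ => ?_
  by_cases hx : x ∈ p.support
  · rw [h x hx]
  · rw [PMF.mem_support_iff, not_not] at hx
    simp [hx]

lemma mean_pure (x : X) (f : X → ℝ) : mean (PMF.pure x) f = f x := by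
  rw [mean, Finset.sum_eq_single x]
  · simp
  · intro y _ hy
    simp [PMF.pure_apply, hy]
  · simp

lemma mean_bind (p : PMF X) (q : X → PMF Y) (f : Y → ℝ) :
    mean (p.bind q) f = mean p fun x => mean (q x) f := by
  have h (y : Y) : ((p.bind q) y).toReal = ∑ x, (p x).toReal * (q x y).toReal := by
    rw [PMF.bind_apply, tsum_fintype, ENNReal.toReal_sum]
    · simp only [ENNReal.toReal_mul]
    · exact fun x _ => ENNReal.mul_ne_top (p.apply_ne_top x) ((q x).apply_ne_top y)
  simp only [mean, h, Finset.sum_mul, Finset.mul_sum]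
  rw [Finset.sum_comm]
  exact Finset.sum_congr rfl fun x _ => Finset.sum_congr rfl fun y _ => by ring

lemma mean_map (p : PMF X) (g : X → Y) (f : Y → ℝ) :
    mean (p.map g) f = mean p fun x => f (g x) := by
  rw [← PMF.bind_pure_comp, mean_bind]
  simp only [Function.comp, mean_pure]

end Mean

/-! ### Product distributions and biased coins -/

section Coins

variable {ι : Type*} [Fintype ι] [DecidableEq ι]

/-- The total variation distance of product distributions is at most the sum of the distances of
their factors. -/
lemma sum_abs_prod_sub_prod_le {κ : Type*} [Fintype κ] (a b : ι → κ → ℝ)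
    (ha : ∀ i x, 0 ≤ a i x) (hb : ∀ i x, 0 ≤ b i x)
    (ha1 : ∀ i, ∑ x, a i x = 1) (hb1 : ∀ i, ∑ x, b i x = 1) :
    ∑ c : ι → κ, |∏ i, a i (c i) - ∏ i, b i (c i)| ≤ ∑ i, ∑ x, |a i x - b i x| := by
  -- Hybrid argument: the factors `b i` are exchanged for `a i` one at a time, `s` being the set
  -- already exchanged.
  have key (s : Finset ι) : ∑ c : ι → κ, |∏ i, (if i ∈ s then a i else b i) (c i)
      - ∏ i, b i (c i)| ≤ ∑ i ∈ s, ∑ x, |a i x - b i x| := by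
    induction s using Finset.induction_on with
    | empty => simp
    | insert i s hi ih =>
      rw [Finset.sum_insert hi]
      have hstep (c : ι → κ) : |∏ j, (if j ∈ insert i s then a j else b j) (c j)
          - ∏ j, (if j ∈ s then a j else b j) (c j)|
          = ∏ j, (if j = i then fun x => |a i x - b i x|
              else if j ∈ s then a j else b j) (c j) := by
        have h1 (j : ι) (hj : j ∈ Finset.univ.erase i) :
            (if j ∈ insert i s then a j else b j) (c j)
              = (if j ∈ s then a j else b j) (c j) := by
          simp [Finset.ne_of_mem_erase hj]
        have h2 (j : ι) (hj : j ∈ Finset.univ.erase i) :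
            (if j = i then fun x => |a i x - b i x| else if j ∈ s then a j else b j) (c j)
              = (if j ∈ s then a j else b j) (c j) := by
          simp [Finset.ne_of_mem_erase hj]
        rw [← Finset.mul_prod_erase _ _ (Finset.mem_univ i),
          ← Finset.mul_prod_erase (a := i) _
            (fun j => (if j ∈ s then a j else b j) (c j)) (Finset.mem_univ i),
          ← Finset.mul_prod_erase (a := i) _
            (fun j => (if j = i then fun x => |a i x - b i x|
              else if j ∈ s then a j else b j) (c j)) (Finset.mem_univ i),
          Finset.prod_congr rfl h1, Finset.prod_congr rfl h2, ← sub_mul, abs_mul]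
        simp only [Finset.mem_insert, true_or, if_true, hi, if_false]
        congr 1
        refine abs_of_nonneg (Finset.prod_nonneg fun j _ => ?_)
        split_ifs
        exacts [ha _ _, hb _ _]
      have hsum : ∑ c : ι → κ, |∏ j, (if j ∈ insert i s then a j else b j) (c j)
          - ∏ j, (if j ∈ s then a j else b j) (c j)| = ∑ x, |a i x - b i x| := by
        simp only [hstep]
        have h := Finset.prod_univ_sum (fun _ : ι => (Finset.univ : Finset κ))
          (fun j x => (if j = i then fun x => |a i x - b i x|
              else if j ∈ s then a j else b j) x)
        rw [Fintype.piFinset_univ] at h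
        rw [← h, Finset.prod_eq_single i]
        · simp
        · intro j _ hj
          simp only [hj, if_false]
          split_ifs
          exacts [ha1 j, hb1 j]
        · simp
      calc _ ≤ ∑ c : ι → κ, (|∏ j, (if j ∈ insert i s then a j else b j) (c j)
              - ∏ j, (if j ∈ s then a j else b j) (c j)|
            + |∏ j, (if j ∈ s then a j else b j) (c j) - ∏ j, b j (c j)|) :=
            Finset.sum_le_sum fun c _ => abs_sub_le _ _ _
        _ ≤ _ := by
            rw [Finset.sum_add_distrib, hsum]
            linarith
  simpa using key Finset.univ

lemma coins_apply_toReal (p : ι → I) (c : ι → Bool) :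
    (coins p c).toReal = ∏ i, if c i = true then (p i : ℝ) else 1 - p i := by
  rw [coins, PMF.ofFintype_apply, ENNReal.toReal_prod]
  refine Finset.prod_congr rfl fun i _ => ?_
  split_ifs
  · exact ENNReal.toReal_ofReal (p i).2.1
  · exact ENNReal.toReal_ofReal (sub_nonneg.2 (p i).2.2)

/-- The factor 2 counts the two faces of each coin. -/
lemma abs_mean_coins_sub_le (p q : ι → I) {f : (ι → Bool) → ℝ} (hf : ∀ c, |f c| ≤ 1) :
    |mean (coins p) f - mean (coins q) f| ≤ 2 * ∑ i, |(p i : ℝ) - q i| := by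
  have h := sum_abs_prod_sub_prod_le
    (fun i (x : Bool) => if x = true then (p i : ℝ) else 1 - p i)
    (fun i (x : Bool) => if x = true then (q i : ℝ) else 1 - q i)
    (fun i x => by split_ifs; exacts [(p i).2.1, sub_nonneg.2 (p i).2.2])
    (fun i x => by split_ifs; exacts [(q i).2.1, sub_nonneg.2 (q i).2.2])
    (fun i => by simp) (fun i => by simp)
  have h2 : ∑ i, ∑ x : Bool, |(if x = true then (p i : ℝ) else 1 - p i)
      - (if x = true then (q i : ℝ) else 1 - q i)| = 2 * ∑ i, |(p i : ℝ) - q i| := by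
    rw [Finset.mul_sum]
    refine Finset.sum_congr rfl fun i _ => ?_
    rw [Fintype.sum_bool]
    simp only [if_true, Bool.false_eq_true, if_false]
    rw [show (1 - (p i : ℝ)) - (1 - q i) = -(p i - q i) by ring, abs_neg, two_mul]
  rw [h2] at h
  refine le_trans ?_ h
  rw [mean, mean, ← Finset.sum_sub_distrib]
  refine (Finset.abs_sum_le_sum_abs _ _).trans (Finset.sum_le_sum fun c _ => ?_)
  rw [← sub_mul, abs_mul, coins_apply_toReal, coins_apply_toReal]
  exact mul_le_of_le_one_right (abs_nonneg _) (hf c)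

lemma mean_coins_eval (p : ι → I) (i : ι) :
    mean (coins p) (fun c => if c i = true then 1 else 0) = p i := by
  have h := Finset.prod_univ_sum (fun _ : ι => (Finset.univ : Finset Bool))
    (fun j x => (if x = true then (p j : ℝ) else 1 - p j) *
      if j = i then (if x = true then 1 else 0) else 1)
  rw [Fintype.piFinset_univ] at h
  have h1 (c : ι → Bool) : (coins p c).toReal * (if c i = true then 1 else 0)
      = ∏ j, (if c j = true then (p j : ℝ) else 1 - p j) *
        if j = i then (if c j = true then 1 else 0) else 1 := by
    rw [Finset.prod_mul_distrib, coins_apply_toReal, Finset.prod_ite_eq' Finset.univ i]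
    simp
  simp only [mean, h1]
  rw [← h, Finset.prod_eq_single i]
  · simp
  · intro j _ hj
    simp [hj]
  · simp

end Coins

/-! ### Stability of the cascade in its weights -/

section Cascade

variable {V : Type*} [Fintype V] [DecidableEq V] {E : Finset (V × V)}

/-- Each step uses fresh coins, so changing the weights in one step costs the same amount in every
state, and the costs add up. -/
lemma abs_mean_dicRun_sub_le (w w' : E → I) (t : ℕ) (s : Finset V × Finset V)
    {f : Finset V × Finset V → ℝ} (hf : ∀ s, |f s| ≤ 1) :
    |mean (dicRun w t s) f - mean (dicRun w' t s) f|
      ≤ t * (2 * ∑ e, |(w e : ℝ) - w' e|) := by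
  induction t generalizing s with
  | zero => simp [dicRun]
  | succ t ih =>
    simp only [dicRun, dicStep, mean_bind, mean_map]
    -- Intermediate process: first step with `w`, all later steps with `w'`.
    refine (abs_sub_le _ (mean (coins w) fun c =>
      mean (dicRun w' t (s.1 ∪ newlyActive s c, newlyActive s c)) f) _).trans ?_
    rw [← mean_sub]
    have h1 := abs_mean_le (p := coins w) fun c =>
      ih (s.1 ∪ newlyActive s c, newlyActive s c)
    have h2 := abs_mean_coins_sub_le w w' fun c =>
      abs_mean_le (p := dicRun w' t (s.1 ∪ newlyActive s c, newlyActive s c)) hf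
    push_cast
    linarith

lemma subset_of_mem_support_dicRun (w : E → I) (t : ℕ) (s s' : Finset V × Finset V)
    (h : s' ∈ (dicRun w t s).support) : s.1 ⊆ s'.1 := by
  induction t generalizing s with
  | zero =>
    simp only [dicRun, PMF.mem_support_pure_iff] at h
    simp [h]
  | succ t ih =>
    simp only [dicRun, PMF.mem_support_bind_iff] at h
    obtain ⟨s1, h1, h2⟩ := h
    simp only [dicStep, PMF.mem_support_map_iff] at h1
    obtain ⟨c, -, rfl⟩ := h1
    exact Finset.subset_union_left.trans (ih _ h2)

lemma subset_of_mem_support_activeDist (w : E → I) (S A : Finset V)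
    (h : A ∈ (activeDist w S).support) : S ⊆ A := by
  simp only [activeDist, PMF.mem_support_map_iff] at h
  obtain ⟨s, hs, rfl⟩ := h
  exact subset_of_mem_support_dicRun w _ _ _ hs

lemma influence_eq_mean (w : E → I) (S : Finset V) (v : V) :
    influence w S v = mean (activeDist w S) fun A => if v ∈ A then 1 else 0 := by
  simp [influence, mean]

lemma influence_mem_Icc (w : E → I) (S : Finset V) (v : V) :
    influence w S v ∈ Set.Icc (0 : ℝ) 1 := by
  rw [influence_eq_mean]
  constructor
  · refine (mean_const (activeDist w S) 0).ge.trans (mean_mono fun A => ?_)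
    split_ifs <;> norm_num
  · refine (mean_mono fun A => ?_).trans (mean_const (activeDist w S) 1).le
    split_ifs <;> norm_num

/-- Influence functions are Lipschitz in the activation probabilities. -/
lemma abs_influence_sub_le (w w' : E → I) (S : Finset V) (v : V) :
    |influence w S v - influence w' S v|
      ≤ Fintype.card V * (2 * ∑ e, |(w e : ℝ) - w' e|) := by
  simp only [influence_eq_mean, activeDist, mean_map]
  exact abs_mean_dicRun_sub_le w w' _ _ fun s => by split_ifs <;> simp

lemma continuous_influence (S : Finset V) (v : V) :
    Continuous fun w : E → I => influence w S v := by
  refine continuous_iff_continuousAt.2 fun w => tendsto_iff_dist_tendsto_zero.2 ?_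
  have h : Continuous fun w' : E → I =>
      (Fintype.card V : ℝ) * (2 * ∑ e, |(w' e : ℝ) - w e|) := by fun_prop
  refine squeeze_zero (fun _ => dist_nonneg)
    (fun w' => abs_influence_sub_le w' w S v) ?_
  have h0 := h.tendsto w
  simp only [sub_self, abs_zero, Finset.sum_const_zero, mul_zero] at h0
  exact h0

end Cascade

/-! ### Unbiased loss estimates from incomplete cascades -/

section Loss

variable {V : Type*} [Fintype V] [DecidableEq V] {E : Finset (V × V)}

/-- An unbiased estimate, from the observed set `x.2` with seeds `x.1`, of the indicator vector of
the active set. -/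
noncomputable def debiased (r : I) (x : Finset V × Finset V) (v : V) : ℝ :=
  if v ∈ x.1 then 1 else if v ∈ x.2 then 1 / (r : ℝ) else 0

/-- The quadratic loss of `F` on an incomplete cascade. -/
noncomputable def observedLoss (r : I) (F : Finset V → V → ℝ) (x : Finset V × Finset V) : ℝ :=
  sqLoss (debiased r x) (F x.1)

lemma debiased_mem_Icc {U : Type*} [DecidableEq U] {r : I} (hr : 0 < (r : ℝ))
    (x : Finset U × Finset U) (v : U) :
    debiased r x v ∈ Set.Icc 0 (1 / (r : ℝ)) := by
  have h1 : 1 ≤ 1 / (r : ℝ) := (one_le_div hr).2 r.2.2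
  unfold debiased
  split_ifs
  exacts [⟨zero_le_one, h1⟩, ⟨by positivity, le_rfl⟩, ⟨le_rfl, by positivity⟩]

/-- A node of `A \ S` is seen with probability r and then counts 1/r. The hypothesis `S ⊆ A` makes
the value 1 on seeds correct. -/
lemma mean_debiased {r : I} (hr : 0 < (r : ℝ)) {S A : Finset V} (hSA : S ⊆ A) (v : V) :
    mean (coins fun _ : V => r)
      (fun c => debiased r (S, S ∪ (A \ S).filter fun v => c v = true) v)
      = if v ∈ A then 1 else 0 := by
  by_cases hS : v ∈ S
  · simp [debiased, hS, hSA hS, mean_const]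
  · by_cases hA : v ∈ A
    · have h (c : V → Bool) : debiased r (S, S ∪ (A \ S).filter fun v => c v = true) v
          = 1 / (r : ℝ) * if c v = true then 1 else 0 := by
        simp [debiased, hS, hA]
      simp only [h]
      rw [mean_const_mul, mean_coins_eval, if_pos hA, one_div_mul_cancel hr.ne']
    · simp [debiased, hS, hA, mean_const]

/-- The terms `x v ^ 2` cancel. The difference is affine in `x`, so an unbiased estimate of `x`
suffices. -/
lemma sqLoss_sub_sqLoss {U : Type*} [Fintype U] (x a b : U → ℝ) :
    sqLoss x a - sqLoss x b
      = 1 / (Fintype.card U : ℝ) * ∑ v, (b v - a v) * (2 * x v - a v - b v) := by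
  rw [sqLoss, sqLoss, ← mul_sub, ← Finset.sum_sub_distrib]
  congr 1
  exact Finset.sum_congr rfl fun v _ => by ring

lemma mean_sqLoss_debiased_sub {r : I} (hr : 0 < (r : ℝ)) {S A : Finset V} (hSA : S ⊆ A)
    (a b : V → ℝ) :
    mean (coins fun _ : V => r) (fun c =>
      sqLoss (debiased r (S, S ∪ (A \ S).filter fun v => c v = true)) a
        - sqLoss (debiased r (S, S ∪ (A \ S).filter fun v => c v = true)) b)
      = sqLoss (fun v => if v ∈ A then 1 else 0) a
        - sqLoss (fun v => if v ∈ A then 1 else 0) b := by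
  simp only [sqLoss_sub_sqLoss]
  rw [mean_const_mul, mean_sum]
  congr 1
  refine Finset.sum_congr rfl fun v _ => ?_
  rw [mean_const_mul, mean_sub, mean_sub, mean_const_mul, mean_const, mean_const,
    mean_debiased hr hSA]

lemma err_eq_mean (P : PMF (Finset V)) (w : E → I) (F : Finset V → V → ℝ) :
    err P w F = mean P fun S => mean (activeDist w S) fun A =>
      sqLoss (fun v => if v ∈ A then 1 else 0) (F S) := rfl

/-- The observed loss estimates differences of squared errors without bias. -/
lemma mean_observedLoss_sub {r : I} (hr : 0 < (r : ℝ)) (P : PMF (Finset V)) (w : E → I)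
    (F G : Finset V → V → ℝ) :
    mean (incompleteCascade P w r) (fun x => observedLoss r F x - observedLoss r G x)
      = err P w F - err P w G := by
  simp only [incompleteCascade, observe, mean_bind, mean_map, err_eq_mean, observedLoss]
  rw [← mean_sub]
  congr 1
  funext S
  rw [← mean_sub]
  exact mean_congr fun A hA =>
    mean_sqLoss_debiased_sub hr (subset_of_mem_support_activeDist w S A hA) _ _

/-- In the factored difference, one factor is at most η and the other at most 2/r. A small η
controls the error of the cover; η = 1 gives the range for Hoeffding. -/
lemma abs_observedLoss_sub_le {r : I} (hr : 0 < (r : ℝ)) {F G : Finset V → V → ℝ} {η : ℝ}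
    (hη : 0 ≤ η) (hF : ∀ S v, F S v ∈ Set.Icc (0 : ℝ) 1) (hG : ∀ S v, G S v ∈ Set.Icc (0 : ℝ) 1)
    (hFG : ∀ S v, |F S v - G S v| ≤ η) (x : Finset V × Finset V) :
    |observedLoss r F x - observedLoss r G x| ≤ 2 / r * η := by
  have h1 : 1 ≤ 1 / (r : ℝ) := (one_le_div hr).2 r.2.2
  have hterm (v : V) :
      |(G x.1 v - F x.1 v) * (2 * debiased r x v - F x.1 v - G x.1 v)| ≤ 2 / r * η := by
    have hy := debiased_mem_Icc hr x v
    have hf := hF x.1 v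
    have hg := hG x.1 v
    rw [abs_mul, abs_sub_comm, mul_comm (2 / (r : ℝ))]
    refine mul_le_mul (hFG _ _) (abs_le.2 ?_) (abs_nonneg _) hη
    rw [show 2 / (r : ℝ) = 2 * (1 / r) by ring]
    constructor <;> linarith [hy.1, hy.2, hf.1, hf.2, hg.1, hg.2]
  have hB : 0 ≤ 2 / (r : ℝ) * η := by positivity
  rw [observedLoss, observedLoss, sqLoss_sub_sqLoss, abs_mul, abs_of_nonneg (by positivity)]
  calc _ ≤ 1 / (Fintype.card V : ℝ) * (Fintype.card V * (2 / r * η)) := by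
        gcongr
        refine (Finset.abs_sum_le_sum_abs _ _).trans ?_
        refine (Finset.sum_le_sum fun v _ => hterm v).trans ?_
        simp
    _ ≤ 2 / r * η := by
        rw [← mul_assoc, one_div]
        exact mul_le_of_le_one_left hB inv_mul_le_one

lemma continuous_observedLoss_influence (r : I) (x : Finset V × Finset V) :
    Continuous fun w : E → I => observedLoss r (influence w) x := by
  have h (v : V) := continuous_influence (E := E) x.1 v
  unfold observedLoss sqLoss
  fun_prop

end Loss

/-! ### Hoeffding's inequality -/

section Concentration

open MeasureTheory ProbabilityTheory

lemma integral_toMeasure_eq_mean {X : Type*} [Fintype X] [MeasurableSpace X]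
    [DiscreteMeasurableSpace X] (p : PMF X) (f : X → ℝ) : ∫ x, f x ∂p.toMeasure = mean p f := by
  rw [PMF.integral_eq_sum]
  rfl

/-- Hoeffding's inequality for independent samples from a finite distribution. -/
lemma pi_mean_add_le_sum {X : Type*} [Fintype X] [MeasurableSpace X] [DiscreteMeasurableSpace X]
    (p : PMF X) {Z : X → ℝ} {b t : ℝ} (hb : 0 ≤ b) (hZ : ∀ x, |Z x| ≤ b) (ht : 0 ≤ t) (M : ℕ) :
    Measure.pi (fun _ : Fin M => p.toMeasure)
      {D | M * (mean p Z + t) ≤ ∑ i, Z (D i)}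
      ≤ ENNReal.ofReal (Real.exp (-(M * t ^ 2 / (2 * b ^ 2)))) := by
  set μ := Measure.pi (fun _ : Fin M => p.toMeasure) with hμ
  have hZm : Measurable Z := Measurable.of_discrete
  have hmean (i : Fin M) : ∫ D, Z (D i) ∂μ = mean p Z := by
    rw [hμ, integral_comp_eval (μ := fun _ : Fin M => p.toMeasure) (i := i)
      hZm.aestronglyMeasurable, integral_toMeasure_eq_mean]
  have hsub (i : Fin M) : HasSubgaussianMGF (fun D : Fin M → X => Z (D i) - mean p Z)
      ((‖b - -b‖₊ / 2) ^ 2) μ := by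
    rw [← hmean i]
    exact hasSubgaussianMGF_of_mem_Icc (hZm.comp (measurable_pi_apply i)).aemeasurable
      (ae_of_all _ fun D => abs_le.1 (hZ (D i)))
  have hind : iIndepFun (fun (i : Fin M) (D : Fin M → X) => Z (D i) - mean p Z) μ :=
    iIndepFun_pi (X := fun _ x => Z x - mean p Z) fun i => (hZm.sub_const _).aemeasurable
  have h := HasSubgaussianMGF.measure_sum_ge_le_of_iIndepFun hind (s := Finset.univ)
    (fun i _ => hsub i) (ε := M * t) (by positivity)
  have hset : {D : Fin M → X | M * (mean p Z + t) ≤ ∑ i, Z (D i)}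
      = {D | M * t ≤ ∑ i, (Z (D i) - mean p Z)} := by
    ext D
    simp only [Set.mem_ofPred_eq, Finset.sum_sub_distrib, Finset.sum_const, Finset.card_univ,
      Fintype.card_fin, nsmul_eq_mul, mul_add]
    constructor <;> intro <;> linarith
  rw [hset, ← ofReal_measureReal]
  refine ENNReal.ofReal_le_ofReal (h.trans_eq ?_)
  congr 1
  have hc : ((∑ _i : Fin M, (‖b - -b‖₊ / 2) ^ 2 : NNReal) : ℝ) = M * b ^ 2 := by
    simp only [Finset.sum_const, Finset.card_univ, Fintype.card_fin, nsmul_eq_mul]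
    push_cast
    rw [Real.norm_eq_abs, abs_of_nonneg (by linarith)]
    ring
  rw [hc]
  -- If M = 0 or b = 0, division by zero makes both exponents 0.
  rcases Nat.eq_zero_or_pos M with rfl | hM
  · simp
  rcases hb.eq_or_lt with rfl | hb
  · simp
  have hM' : (0 : ℝ) < M := by exact_mod_cast hM
  field_simp

end Concentration

/-! ### Empirical risk minimization, grid cover and sample size -/

section Learning

open MeasureTheory

variable {V : Type*} [Fintype V] [DecidableEq V] {E : Finset (V × V)}

lemma isCompact_boundedWeights {U : Type*} (B : Finset (U × U)) (lam : ℝ) :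
    IsCompact (boundedWeights B lam) := by
  refine IsClosed.isCompact ?_
  simp only [boundedWeights, Set.ofPred_forall]
  exact isClosed_iInter fun e => isClosed_Icc.preimage (by fun_prop)

lemma boundedWeights_nonempty {U : Type*} (B : Finset (U × U)) {lam : ℝ} (h : lam ≤ 1 / 2) :
    (boundedWeights B lam).Nonempty :=
  ⟨fun _ => ⟨1 / 2, by norm_num, by norm_num⟩, fun _ => ⟨h, by dsimp only; linarith⟩⟩

lemma exists_empirical_minimizer {lam : ℝ} (h : lam ≤ 1 / 2) (r : I) {M : ℕ}
    (D : Fin M → Finset V × Finset V) :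
    ∃ w ∈ boundedWeights E lam, ∀ w' ∈ boundedWeights E lam,
      ∑ i, observedLoss r (influence w) (D i) ≤ ∑ i, observedLoss r (influence w') (D i) :=
  (isCompact_boundedWeights E lam).exists_isMinOn (boundedWeights_nonempty E h)
    (continuous_finsetSum _ fun i _ => continuous_observedLoss_influence r (D i)).continuousOn

/-- The points of the regular grid with `K + 1` points in the unit interval. -/
noncomputable def gridPoint (K : ℕ) (j : Fin (K + 1)) : I :=
  ⟨j / K, by positivity, div_le_one_of_le₀ (by exact_mod_cast Nat.lt_succ_iff.1 j.2)
    (by positivity)⟩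

lemma exists_abs_sub_gridPoint_le {K : ℕ} (hK : 0 < K) (x : I) :
    ∃ j, |(x : ℝ) - gridPoint K j| ≤ 1 / K := by
  have hK' : (0 : ℝ) < K := by exact_mod_cast hK
  have hx : 0 ≤ (x : ℝ) * K := mul_nonneg x.2.1 hK'.le
  have hj : ⌊(x : ℝ) * K⌋₊ < K + 1 := by
    refine Nat.lt_succ_iff.2 (Nat.floor_le_of_le ?_)
    exact mul_le_of_le_one_left hK'.le x.2.2
  refine ⟨⟨_, hj⟩, ?_⟩
  have h1 := Nat.floor_le hx
  have h2 := (Nat.lt_floor_add_one ((x : ℝ) * K)).le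
  have he : (x : ℝ) - gridPoint K ⟨_, hj⟩ = ((x : ℝ) * K - ⌊(x : ℝ) * K⌋₊) / K := by
    simp only [gridPoint]
    field_simp
  rw [he, abs_of_nonneg (div_nonneg (by linarith) hK'.le)]
  gcongr
  linarith

/-- The grid vector may leave `boundedWeights`; this is harmless, as the grid serves only the
analysis and not the learner. -/
lemma exists_grid_abs_influence_sub_le {K : ℕ} (hK : 0 < K) (w : E → I) :
    ∃ g : E → Fin (K + 1), ∀ S v,
      |influence w S v - influence (fun e => gridPoint K (g e)) S v|
        ≤ Fintype.card V * (2 * (E.card * (1 / K))) := by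
  choose g hg using fun e => exists_abs_sub_gridPoint_le hK (w e)
  refine ⟨g, fun S v => (abs_influence_sub_le _ _ S v).trans ?_⟩
  gcongr
  refine (Finset.sum_le_sum fun e _ => hg e).trans ?_
  simp

/-- Empirical risk minimization fails with small probability. -/
lemma measure_excess_err_le {r : I} (hr : 0 < (r : ℝ)) (P : PMF (Finset V)) (w : E → I)
    {ε : ℝ} (hε : 0 < ε) {K : ℕ} (hK : 0 < K)
    (hKε : 16 * (Fintype.card V * E.card : ℝ) ≤ ε * r * K) {M : ℕ}
    (what : (Fin M → Finset V × Finset V) → E → I)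
    (hmin : ∀ D, ∑ i, observedLoss r (influence (what D)) (D i)
      ≤ ∑ i, observedLoss r (influence w) (D i)) :
    Measure.pi (fun _ : Fin M => (incompleteCascade P w r).toMeasure)
      {D | ε ≤ err P w (influence (what D)) - err P w (influence w)}
      ≤ ENNReal.ofReal ((K + 1) ^ E.card * Real.exp (-(M * (ε ^ 2 * r ^ 2 / 32)))) := by
  let Z (g : E → Fin (K + 1)) (x : Finset V × Finset V) : ℝ :=
    observedLoss r (influence w) x - observedLoss r (influence fun e => gridPoint K (g e)) x
  have hsub : {D : Fin M → Finset V × Finset V |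
      -- On the bad event, let g be the grid vector near the minimizer. The mean of `Z g` is at most
      -- -ε + ε/4, while minimality makes its empirical average at least -ε/4: a deviation of at
      -- least ε/2.
      ε ≤ err P w (influence (what D)) - err P w (influence w)}
      ⊆ ⋃ g : E → Fin (K + 1),
        {D | M * (mean (incompleteCascade P w r) (Z g) + ε / 2) ≤ ∑ i, Z g (D i)} := by
    intro D hD
    rw [Set.mem_ofPred_eq] at hD
    obtain ⟨g, hg⟩ := exists_grid_abs_influence_sub_le hK (what D)
    refine Set.mem_iUnion.2 ⟨g, ?_⟩
    rw [Set.mem_ofPred_eq]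
    set w' : E → I := fun e => gridPoint K (g e) with hw'
    have hclose (x : Finset V × Finset V) :
        |observedLoss r (influence (what D)) x - observedLoss r (influence w') x| ≤ ε / 4 := by
      refine (abs_observedLoss_sub_le hr (by positivity) (influence_mem_Icc _)
        (influence_mem_Icc _) hg x).trans ?_
      have hK' : (0 : ℝ) < K := by exact_mod_cast hK
      have he : 2 / (r : ℝ) * (Fintype.card V * (2 * (E.card * (1 / K))))
          = 4 * (Fintype.card V * E.card) / (r * K) := by
        field_simp
        ring
      rw [he, div_le_iff₀ (by positivity)]
      linarith
    have herr := abs_mean_le (p := incompleteCascade P w r) hclose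
    rw [mean_observedLoss_sub hr] at herr
    have hZ : mean (incompleteCascade P w r) (Z g)
        = err P w (influence w) - err P w (influence w') := mean_observedLoss_sub hr P w _ _
    have hsum : -(M * (ε / 4)) ≤ ∑ i, Z g (D i) := by
      have h2 : ∑ i, (observedLoss r (influence w') (D i)
          - observedLoss r (influence (what D)) (D i)) ≤ ∑ _i : Fin M, ε / 4 :=
        Finset.sum_le_sum fun i _ => by linarith [(abs_le.1 (hclose (D i))).1]
      simp only [Finset.sum_sub_distrib, Finset.sum_const, Finset.card_univ, Fintype.card_fin,
        nsmul_eq_mul] at h2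
      have h3 := hmin D
      simp only [Z, Finset.sum_sub_distrib]
      linarith
    refine le_trans ?_ hsum
    rw [hZ, ← mul_neg]
    refine mul_le_mul_of_nonneg_left ?_ (Nat.cast_nonneg M)
    linarith [(abs_le.1 herr).2]
  refine (measure_mono hsub).trans ((measure_iUnion_fintype_le _ _).trans ?_)
  have hZb (g : E → Fin (K + 1)) (x : Finset V × Finset V) : |Z g x| ≤ 2 / r := by
    refine (abs_observedLoss_sub_le hr zero_le_one (influence_mem_Icc _)
      (influence_mem_Icc _) (fun S v => ?_) x).trans_eq (mul_one _)
    have h1 := influence_mem_Icc w S v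
    have h2 := influence_mem_Icc (fun e => gridPoint K (g e)) S v
    exact abs_le.2 ⟨by linarith [h1.1, h2.2], by linarith [h1.2, h2.1]⟩
  refine (Finset.sum_le_sum fun g _ => pi_mean_add_le_sum (incompleteCascade P w r)
    (by positivity) (hZb g) (t := ε / 2) (by positivity) M).trans ?_
  rw [Finset.sum_const, nsmul_eq_mul, Finset.card_univ, Fintype.card_fun, Fintype.card_fin,
    Fintype.card_coe, ENNReal.ofReal_mul (by positivity)]
  refine mul_le_mul' ?_ (le_of_eq ?_)
  · rw [← ENNReal.ofReal_natCast]
    push_cast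
    exact le_rfl
  -- With t = ε/2 and b = 2/r, t²/(2b²) = ε²r²/32.
  · congr 4
    field_simp
    ring

/-- The number of samples in the main theorem suffices for the union bound. -/
lemma union_bound_le {n m M : ℕ} (hn : 1 ≤ n) (hm : 1 ≤ m) {ε δ r : ℝ} (hε : ε ∈ Set.Ioo (0 : ℝ) 1)
    (hδ : δ ∈ Set.Ioo (0 : ℝ) 1) (hr : 0 < r) (hr1 : r ≤ 1)
    (hM : 224 * ((n : ℝ) ^ 3 * m / (ε ^ 2 * r ^ 4))
      * Real.log (2 + n + m + 1 / ε + 1 / δ + 1 / r) ^ 1 ≤ M) :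
    ((⌈16 * (n * m : ℝ) / (ε * r)⌉₊ : ℝ) + 1) ^ m * Real.exp (-(M * (ε ^ 2 * r ^ 2 / 32)))
      ≤ δ := by
  set X : ℝ := 2 + n + m + 1 / ε + 1 / δ + 1 / r with hX
  have hε0 := hε.1
  have hδ0 := hδ.1
  have hn' : (1 : ℝ) ≤ n := by exact_mod_cast hn
  have hm' : (1 : ℝ) ≤ m := by exact_mod_cast hm
  have hε1 : 1 ≤ 1 / ε := (one_le_div hε0).2 hε.2.le
  have hδ1 : 1 ≤ 1 / δ := (one_le_div hδ0).2 hδ.2.le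
  have hr2 : 1 ≤ 1 / r := (one_le_div hr).2 hr1
  have hX7 : 7 ≤ X := by linarith
  have hδX : 1 / δ ≤ X := by linarith
  have hnX : n ≤ X := by linarith
  have hmX : m ≤ X := by linarith
  have hεX : 1 / ε ≤ X := by linarith
  have hrX : 1 / r ≤ X := by linarith
  clear_value X
  have hlogX : 0 < Real.log X := Real.log_pos (by linarith)
  -- The left side is at most 16X⁴ + 2, and X² ≥ 49.
  have hK : (⌈16 * (n * m : ℝ) / (ε * r)⌉₊ : ℝ) + 1 ≤ X ^ 6 := by
    have h1 := (Nat.ceil_lt_add_one (a := 16 * (n * m : ℝ) / (ε * r)) (by positivity)).le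
    have h2 : 16 * (n * m : ℝ) / (ε * r) = 16 * (n * m * (1 / ε) * (1 / r)) := by
      field_simp
    have h3 : n * m * (1 / ε) * (1 / r) ≤ X * X * X * X := by
      gcongr
    have h4 : X * X * X * X = X ^ 4 := by ring
    have h5 : (49 : ℝ) ≤ X ^ 2 := by nlinarith
    have h6 : (1 : ℝ) ≤ X ^ 4 := one_le_pow₀ (by linarith)
    have h7 : X ^ 6 = X ^ 2 * X ^ 4 := by ring
    nlinarith
  -- Here 224 = 7 · 32. Of the 7m powers of X, 6m pay for the grid and the remaining m ≥ 1 for δ.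
  -- The factors n³ and r⁻² are slack.
  have hM2 : 7 * m * Real.log X ≤ M * (ε ^ 2 * r ^ 2 / 32) := by
    have h1 : (m : ℝ) / (ε ^ 2 * r ^ 2) ≤ (n : ℝ) ^ 3 * m / (ε ^ 2 * r ^ 4) := by
      gcongr ?_ / ?_
      · exact le_mul_of_one_le_left (by positivity) (one_le_pow₀ hn')
      · exact mul_le_mul_of_nonneg_left
          (pow_le_pow_of_le_one hr.le hr1 (by norm_num)) (by positivity)
    have h2 : 224 * (m / (ε ^ 2 * r ^ 2)) * Real.log X ≤ M := by
      refine le_trans ?_ hM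
      rw [pow_one]
      exact mul_le_mul_of_nonneg_right (mul_le_mul_of_nonneg_left h1 (by norm_num)) hlogX.le
    calc 7 * m * Real.log X
        = 224 * (m / (ε ^ 2 * r ^ 2)) * Real.log X * (ε ^ 2 * r ^ 2 / 32) := by
          field_simp
          ring
      _ ≤ _ := mul_le_mul_of_nonneg_right h2 (by positivity)
  have hexp : Real.exp (-(M * (ε ^ 2 * r ^ 2 / 32))) ≤ (X ^ (7 * m))⁻¹ := by
    rw [Real.exp_neg]
    have h1 : X ^ (7 * m) = Real.exp ((7 * m : ℕ) * Real.log X) := by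
      rw [Real.exp_nat_mul, Real.exp_log (by linarith)]
    rw [h1]
    refine inv_anti₀ (Real.exp_pos _) (Real.exp_le_exp.2 ?_)
    push_cast
    exact hM2
  calc _ ≤ (X ^ 6) ^ m * (X ^ (7 * m))⁻¹ := by gcongr
    _ = (X ^ m)⁻¹ := by
        rw [← pow_mul, show 7 * m = 6 * m + m by ring, pow_add]
        have : X ≠ 0 := by linarith
        field_simp
    _ ≤ X⁻¹ := by
        gcongr
        exact le_self_pow₀ (by linarith) (by omega)
    _ ≤ δ := by
        rw [inv_le_comm₀ (by linarith) hδ0, ← one_div]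
        exact hδX

end Learning

end Influence

/-- There are absolute constants `C` and `k` such that on every directed graph with `n` nodes and
`m` edges, the class of influence functions with activation probabilities in `[lam, 1 - lam]` is
properly PAC learnable under retention rate `r` from
`C * n³ m / (ε² r⁴) * log(2 + n + m + 1/ε + 1/δ + 1/r) ^ k` incomplete cascades. -/
theorem theorem1 :
    ∃ C : ℝ, 0 < C ∧ ∃ k : ℕ,
      ∀ lam : ℝ, lam ∈ Set.Ioo (0 : ℝ) (1 / 2) →
      ∀ r : unitInterval, 0 < (r : ℝ) →
      ∀ (V : Type*) [Fintype V] [DecidableEq V] (E : Finset (V × V)),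
        Influence.ProperlyPACLearnable E lam r (fun ε δ =>
          C * ((Fintype.card V : ℝ) ^ 3 * (E.card : ℝ) / (ε ^ 2 * (r : ℝ) ^ 4)) *
            Real.log (2 + (Fintype.card V : ℝ) + (E.card : ℝ) + 1 / ε + 1 / δ + 1 / (r : ℝ)) ^ k)
    := by
  refine ⟨224, by norm_num, 1, fun lam hlam r hr V _ _ E => ?_⟩
  choose what hwhat hmin using fun (M : ℕ) (D : Fin M → Finset V × Finset V) =>
    Influence.exists_empirical_minimizer (E := E) hlam.2.le r D
  refine ⟨fun M D => Influence.influence (what M D), fun M D => ⟨_, hwhat M D, rfl⟩, ?_⟩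
  intro ε hε δ hδ w hw P M hM
  -- Without edges the sample bound is 0, so M = 0 is allowed, but there is only one weight vector
  -- and the excess error vanishes. An edge forces n, m ≥ 1.
  rcases E.eq_empty_or_nonempty with rfl | hE
  · have h : {D : Fin M → Finset V × Finset V | ε ≤ Influence.err P w
        (Influence.influence (what M D)) - Influence.err P w (Influence.influence w)} = ∅ := by
      refine Set.eq_empty_of_forall_notMem fun D hD => ?_
      rw [Set.mem_ofPred_eq, Subsingleton.elim (what M D) w, sub_self] at hD
      exact absurd hε.1 (not_lt.2 hD)
    rw [h, MeasureTheory.measure_empty]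
    exact zero_le
  · have hm : 1 ≤ E.card := hE.card_pos
    have hn : 1 ≤ Fintype.card V := Fintype.card_pos_iff.2 ⟨hE.choose.1⟩
    have hε0 := hε.1
    have hK : 0 < 16 * ((Fintype.card V * E.card : ℝ)) / (ε * r) := by positivity
    refine (Influence.measure_excess_err_le hr P w hε.1 (Nat.ceil_pos.2 hK) ?_ (what M)
      fun D => hmin M D w hw).trans
      (ENNReal.ofReal_le_ofReal (Influence.union_bound_le hn hm hε hδ hr r.2.2 hM))
    rw [mul_comm (ε * (r : ℝ)), ← div_le_iff₀ (by positivity)]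
    exact Nat.le_ceil _
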